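/- Let $R$ be an associative ring with unit, and let $V(R)$ be the commutative monoid of isomorphism classes of finitely generated projective right $R$-modules, with addition induced by direct sum. Suppose that $R$ is a refinement ring, that is, $V(R)$ has the refinement property: whenever $\sum_{i=1}^{n} x_i=\sum_{j=1}^{m} y_j$ in $V(R)$ with $n,m\ge 2$, there are $z_{ij}\in V(R)$ with $x_i=\sum_j z_{ij}$ for all $i$ and $y_j=\sum_i z_{ij}$ for all $j$. Then the following two conditions are equivalent. (1) For all $m,n$, every regular $m\times n$ matrix over $R$ admits a diagonal reduction. (2) For all finitely generated projective right $R$-modules $A,B$: if $2R\oplus A\cong R\oplus B$, then $R\oplus A\cong B$. Here $kR$ is the direct sum of $k$ copies of $R$. An $m\times n$ matrix $f$ over $R$ is regular if $fgf=f$ for some $n\times m$ matrix $g$ over $R$. It admits a diagonal reduction if there are invertible matrices $P$ ($m\times m$) and $Q$ ($n\times n$) over $R$ such that every entry of $PfQ$ in a position $(i,j)$ with $i\ne j$ is zero. -/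

import Mathlib

universe u

namespace RefinementRing

/-- The refinement property of a commutative monoid: two equal finite sums, of at least two terms
each, have a common refinement. -/
def HasRefinement (M : Type*) [AddCommMonoid M] : Prop :=
  ∀ (n m : ℕ), 2 ≤ n → 2 ≤ m → ∀ (x : Fin n → M) (y : Fin m → M),
    ∑ i, x i = ∑ j, y j →
      ∃ z : Fin n → Fin m → M, (∀ i, x i = ∑ j, z i j) ∧ (∀ j, y j = ∑ i, z i j)

/-- A finitely generated projective right `R`-module. Right `R`-modules are modules over the
opposite ring `Rᵐᵒᵖ`. -/
structure FGProj (R : Type u) [Ring R] where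
  carrier : Type u
  [addCommGroup : AddCommGroup carrier]
  [module : Module Rᵐᵒᵖ carrier]
  [finite : Module.Finite Rᵐᵒᵖ carrier]
  [projective : Module.Projective Rᵐᵒᵖ carrier]

attribute [instance] FGProj.addCommGroup FGProj.module FGProj.finite FGProj.projective

/-- Isomorphism of finitely generated projective right modules, as a setoid. -/
instance FGProj.isoSetoid (R : Type u) [Ring R] : Setoid (FGProj R) where
  r A B := Nonempty (A.carrier ≃ₗ[Rᵐᵒᵖ] B.carrier)
  iseqv :=
    { refl := fun _ => ⟨LinearEquiv.refl _ _⟩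
      symm := fun ⟨e⟩ => ⟨e.symm⟩
      trans := fun ⟨e⟩ ⟨f⟩ => ⟨e.trans f⟩ }

/-- The direct sum of two finitely generated projective right modules. -/
def FGProj.sum {R : Type u} [Ring R] (A B : FGProj R) : FGProj R where
  carrier := A.carrier × B.carrier

/-- The zero module. -/
def FGProj.zero (R : Type u) [Ring R] : FGProj R where
  carrier := PUnit.{u + 1}

/-- `V(R)`: the isomorphism classes of finitely generated projective right `R`-modules. -/
def V (R : Type u) [Ring R] : Type (u + 1) := Quotient (FGProj.isoSetoid R)

/-- The isomorphism class `[A]`. -/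
def V.mk {R : Type u} [Ring R] (A : FGProj R) : V R := Quotient.mk (FGProj.isoSetoid R) A

instance (R : Type u) [Ring R] : Zero (V R) := ⟨V.mk (FGProj.zero R)⟩

instance (R : Type u) [Ring R] : Add (V R) :=
  ⟨Quotient.map₂ FGProj.sum (fun _ _ ⟨e⟩ _ _ ⟨f⟩ => ⟨LinearEquiv.prodCongr e f⟩)⟩

/-- `V(R)` is a commutative monoid under `[A] + [B] = [A ⊕ B]`. -/
instance (R : Type u) [Ring R] : AddCommMonoid (V R) where
  add_assoc := by
    rintro ⟨A⟩ ⟨B⟩ ⟨C⟩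
    exact Quotient.sound
      ⟨LinearEquiv.prodAssoc Rᵐᵒᵖ A.carrier B.carrier C.carrier⟩
  zero_add := by
    rintro ⟨A⟩
    exact Quotient.sound
      ⟨(LinearEquiv.uniqueProd : (PUnit.{u + 1} × A.carrier) ≃ₗ[Rᵐᵒᵖ] A.carrier)⟩
  add_zero := by
    rintro ⟨A⟩
    exact Quotient.sound
      ⟨(LinearEquiv.prodUnique : (A.carrier × PUnit.{u + 1}) ≃ₗ[Rᵐᵒᵖ] A.carrier)⟩
  add_comm := by
    rintro ⟨A⟩ ⟨B⟩
    exact Quotient.sound ⟨LinearEquiv.prodComm Rᵐᵒᵖ A.carrier B.carrier⟩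
  nsmul := nsmulRec

/-- A refinement ring: the monoid `V(R)` has the refinement property. -/
def IsRefinementRing (R : Type u) [Ring R] : Prop := HasRefinement (V R)

/-- A (possibly rectangular) matrix `f` is regular if `f g f = f` for some matrix `g` of the
transposed size. -/
def IsRegularMatrix {R : Type u} [Ring R] {m n : ℕ} (f : Matrix (Fin m) (Fin n) R) : Prop :=
  ∃ g : Matrix (Fin n) (Fin m) R, f * g * f = f

/-- `A` admits a diagonal reduction: `P A Q` is diagonal (its `(i, j)` entry is zero whenever
`i ≠ j`) for some invertible square matrices `P` and `Q`. -/
def AdmitsDiagonalReduction {R : Type u} [Ring R] {m n : ℕ}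
    (A : Matrix (Fin m) (Fin n) R) : Prop :=
  ∃ (P : (Matrix (Fin m) (Fin m) R)ˣ) (Q : (Matrix (Fin n) (Fin n) R)ˣ),
    ∀ (i : Fin m) (j : Fin n), (i : ℕ) ≠ (j : ℕ) →
      ((P : Matrix (Fin m) (Fin m) R) * A * (Q : Matrix (Fin n) (Fin n) R)) i j = 0

end RefinementRing

namespace RefinementRing

/-! ### Cancellation and refinement in a commutative monoid. -/

section Monoid

variable {M : Type*} [AddCommMonoid M]

/-! A regular map `nR → mR` splits, so up to automorphisms of source and target it is determined by
the classes `k`, `i`, `c` of kernel, image and cokernel, where `k + i = n • u`, `i + c = m • u` and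
`u = [R]` (`IsRegularMap.exists_hasType`, `HasType.equivalent`). It is therefore diagonalizable once
some diagonal map has the same triple, and such maps are built from `1 × 1` blocks and a zero
rectangle. Thus (2) ⇒ (1) becomes a problem in `V(R)`: remove the excess rows or columns
(`CancelsTwo.exists_eq_add_nsmul`), then peel blocks off the square triple (`CancelsTwo.split`).

For (1) ⇒ (2), refining `2u + a = u + b` produces the triple of a regular `1 × 2` matrix;
diagonalizing it splits a copy of `u` off the kernel, which gives `u + a = b`. Only this size is
needed. -/

theorem HasRefinement.two_two (h : HasRefinement M) {a b c d : M} (e : a + b = c + d) :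
    ∃ p q r s : M, a = p + q ∧ b = r + s ∧ c = p + r ∧ d = q + s := by
  obtain ⟨z, h₁, h₂⟩ := h 2 2 le_rfl le_rfl ![a, b] ![c, d] (by simpa using e)
  refine ⟨z 0 0, z 0 1, z 1 0, z 1 1, ?_, ?_, ?_, ?_⟩
  · simpa using h₁ 0
  · simpa using h₁ 1
  · simpa using h₂ 0
  · simpa using h₂ 1

/-- The cancellation law `2u + a = u + b → u + a = b` for an element `u` of a monoid. -/
def CancelsTwo (u : M) : Prop := ∀ a b : M, u + u + a = u + b → u + a = b

/-- Copies of `u` cancel one at a time because the summand `u + c` always keeps one on the left. -/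
theorem CancelsTwo.nsmul {u : M} (h : CancelsTwo u) {b c k : M} (m : ℕ)
    (e : (b + m • u) + (u + c) = k + m • u) : b + (u + c) = k := by
  induction m with
  | zero => simpa using e
  | succ m ih =>
    apply ih
    have : u + ((b + m • u) + c) = k + m • u := by
      apply h
      rw [succ_nsmul] at e
      calc u + u + (b + m • u + c) = b + (m • u + u) + (u + c) := by abel
        _ = u + (k + m • u) := by rw [e]; abel
    rw [← this]; abel

/-- In a rectangular situation, the larger complement absorbs the extra copies of `u`. -/
theorem CancelsTwo.exists_eq_add_nsmul {u : M} (h : CancelsTwo u) {k i c : M} (m b : ℕ)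
    (hk : k + i = (b + m) • u) (hc : i + c = m • u) :
    ∃ k', k = k' + b • u ∧ k' + i = m • u := by
  cases b with
  | zero => exact ⟨k, by simp, by simpa using hk⟩
  | succ b =>
    -- With a surplus copy of `u` available, adding `c` to `hk` and cancelling `m • u` forces `k = c
    -- + (b + 1) • u`.
    refine ⟨c, ?_, by rw [add_comm, hc]⟩
    have e : (b • u + m • u) + (u + c) = k + m • u := by
      calc _ = (b + 1 + m) • u + c := by rw [add_nsmul, succ_nsmul]; abel
        _ = k + m • u := by rw [← hk, add_assoc, hc]
    rw [← h.nsmul m e, succ_nsmul]; abel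

/-- A refinement argument making simultaneous decompositions of two complements of `i`. -/
theorem CancelsTwo.split {u : M} (h : CancelsTwo u) (hM : HasRefinement M) {k i c : M} (n : ℕ)
    (hk : k + i = (n + 2) • u) (hc : i + c = (n + 2) • u) :
    ∃ k₁ k₂ i₁ i₂ c₁ c₂ : M, k = k₂ + k₁ ∧ i = i₂ + i₁ ∧ c = c₂ + c₁ ∧
      k₁ + i₁ = u ∧ i₁ + c₁ = u ∧ k₂ + i₂ = (n + 1) • u ∧ i₂ + c₂ = (n + 1) • u := by
  have e₁ : i + c = u + (n + 1) • u := by rw [hc, succ_nsmul _ (n + 1), add_comm]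
  obtain ⟨p, q, c₁, c₂, rfl, rfl, hu, hn⟩ := hM.two_two e₁
  -- Here `i = p + q` and `u = p + c₁`. Adding `c₁` to `hk` puts `u` on both sides; the size `n + 2
  -- ≥ 2` leaves a second copy, so it cancels.
  have e₂ : u + (n • u + c₁) = k + q := by
    apply h
    calc u + u + (n • u + c₁) = (n + 2) • u + c₁ := by
          rw [succ_nsmul, succ_nsmul]; abel
      _ = (k + q) + (p + c₁) := by rw [← hk]; abel
      _ = u + (k + q) := by rw [← hu]; abel
  have e₃ : k + q = (n + 1) • u + c₁ := by rw [← e₂, succ_nsmul]; abel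
  obtain ⟨k₂, r, q₂, s, rfl, rfl, hn', rfl⟩ := hM.two_two e₃
  -- Now `u = p + r + s`. Moving `s` from the cokernel to the image of the first block leaves `r` as
  -- both its kernel and its cokernel.
  refine ⟨r, k₂, p + s, q₂, r, s + c₂, rfl, by abel, by abel, ?_, ?_, hn'.symm, ?_⟩
  · rw [hu]; abel
  · rw [hu]; abel
  · rw [hn]; abel

end Monoid

variable {R : Type u} [Ring R]

/-! ### Classes in `V(R)` of free modules. -/

section Classes

variable (R) in
/-- The class in `V(R)` of a finitely generated projective right module. -/
def V.of (X : Type u) [AddCommGroup X] [Module Rᵐᵒᵖ X] [Module.Finite Rᵐᵒᵖ X]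
    [Module.Projective Rᵐᵒᵖ X] : V R := V.mk ⟨X⟩

theorem V.mk_eq_mk {A B : FGProj R} :
    V.mk A = V.mk B ↔ Nonempty (A.carrier ≃ₗ[Rᵐᵒᵖ] B.carrier) := Quotient.eq

theorem V.exists_rep (a : V R) : ∃ A : FGProj R, V.mk A = a := Quotient.exists_rep a

variable {X Y : Type u} [AddCommGroup X] [Module Rᵐᵒᵖ X] [AddCommGroup Y] [Module Rᵐᵒᵖ Y]

theorem V.of_eq_of [Module.Finite Rᵐᵒᵖ X] [Module.Projective Rᵐᵒᵖ X] [Module.Finite Rᵐᵒᵖ Y]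
    [Module.Projective Rᵐᵒᵖ Y] : V.of R X = V.of R Y ↔ Nonempty (X ≃ₗ[Rᵐᵒᵖ] Y) := V.mk_eq_mk

theorem V.of_prod [Module.Finite Rᵐᵒᵖ X] [Module.Projective Rᵐᵒᵖ X] [Module.Finite Rᵐᵒᵖ Y]
    [Module.Projective Rᵐᵒᵖ Y] : V.of R (X × Y) = V.of R X + V.of R Y := rfl

instance : Module.Projective Rᵐᵒᵖ R :=
  Module.Projective.of_equiv (MulOpposite.opLinearEquiv Rᵐᵒᵖ : R ≃ₗ[Rᵐᵒᵖ] Rᵐᵒᵖ).symm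

instance : Module.Finite Rᵐᵒᵖ R :=
  Module.Finite.equiv (MulOpposite.opLinearEquiv Rᵐᵒᵖ : R ≃ₗ[Rᵐᵒᵖ] Rᵐᵒᵖ).symm

instance (n : ℕ) : Module.Projective Rᵐᵒᵖ (Fin n → R) :=
  Module.Projective.of_equiv (LinearEquiv.piCongrRight fun _ : Fin n =>
    (MulOpposite.opLinearEquiv Rᵐᵒᵖ : R ≃ₗ[Rᵐᵒᵖ] Rᵐᵒᵖ)).symm

theorem V.of_fin (n : ℕ) : V.of R (Fin n → R) = n • V.of R R := by
  induction n with
  | zero =>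
    rw [zero_nsmul]
    exact (V.mk_eq_mk (A := ⟨Fin 0 → R⟩) (B := FGProj.zero R)).2
      ⟨(0 : (Fin 0 → R) ≃ₗ[Rᵐᵒᵖ] PUnit.{u + 1})⟩
  | succ n ih =>
    rw [succ_nsmul', ← ih, ← V.of_prod, V.of_eq_of]
    exact ⟨(Fin.consLinearEquiv Rᵐᵒᵖ fun _ : Fin (n + 1) => R).symm⟩

end Classes

/-! ### Split maps classified by kernel, image and cokernel. -/

section Types

variable {X Y X' Y' : Type u} [AddCommGroup X] [Module Rᵐᵒᵖ X] [AddCommGroup Y] [Module Rᵐᵒᵖ Y]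
  [AddCommGroup X'] [Module Rᵐᵒᵖ X'] [AddCommGroup Y'] [Module Rᵐᵒᵖ Y']

/-- Up to isomorphisms of source and target, `f` is the map `I × K → I × C`, `(x, y) ↦ (x, 0)`,
where `K`, `I`, `C` are finitely generated projective modules with classes `k`, `i`, `c`. -/
def HasType (f : X →ₗ[Rᵐᵒᵖ] Y) (k i c : V R) : Prop :=
  ∃ K I C : FGProj R, V.mk K = k ∧ V.mk I = i ∧ V.mk C = c ∧
    ∃ (α : X ≃ₗ[Rᵐᵒᵖ] I.carrier × K.carrier) (β : Y ≃ₗ[Rᵐᵒᵖ] I.carrier × C.carrier),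
      ∀ x, β (f x) = ((α x).1, 0)

/-- Von Neumann regularity of a linear map. -/
def IsRegularMap (f : X →ₗ[Rᵐᵒᵖ] Y) : Prop := ∃ g : Y →ₗ[Rᵐᵒᵖ] X, ∀ x, f (g (f x)) = f x

theorem HasType.isRegularMap {f : X →ₗ[Rᵐᵒᵖ] Y} {k i c : V R} (h : HasType f k i c) :
    IsRegularMap f := by
  obtain ⟨K, I, C, -, -, -, α, β, h⟩ := h
  refine ⟨α.symm.toLinearMap ∘ₗ LinearMap.inl _ _ _ ∘ₗ LinearMap.fst _ _ _ ∘ₗ β.toLinearMap,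
    fun x => β.injective ?_⟩
  simp [h]

theorem HasType.equivalent {f g : X →ₗ[Rᵐᵒᵖ] Y} {k i c : V R} (hf : HasType f k i c)
    (hg : HasType g k i c) :
    ∃ (φ : X ≃ₗ[Rᵐᵒᵖ] X) (ψ : Y ≃ₗ[Rᵐᵒᵖ] Y), ∀ x, ψ (f (φ x)) = g x := by
  obtain ⟨K, I, C, rfl, rfl, rfl, α, β, hf⟩ := hf
  obtain ⟨K', I', C', hK, hI, hC, α', β', hg⟩ := hg
  obtain ⟨eK⟩ := V.mk_eq_mk.1 hK
  obtain ⟨eI⟩ := V.mk_eq_mk.1 hI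
  obtain ⟨eC⟩ := V.mk_eq_mk.1 hC
  refine ⟨α' ≪≫ₗ (eI.prodCongr eK) ≪≫ₗ α.symm, β ≪≫ₗ (eI.prodCongr eC).symm ≪≫ₗ β'.symm,
    fun x => β'.injective ?_⟩
  simp [hf, hg, LinearEquiv.prodCongr_symm]

theorem HasType.comp_equiv {f : X →ₗ[Rᵐᵒᵖ] Y} {k i c : V R} (h : HasType f k i c)
    (φ : X' ≃ₗ[Rᵐᵒᵖ] X) (ψ : Y ≃ₗ[Rᵐᵒᵖ] Y') :
    HasType (ψ.toLinearMap ∘ₗ f ∘ₗ φ.toLinearMap) k i c := by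
  obtain ⟨K, I, C, hK, hI, hC, α, β, h⟩ := h
  exact ⟨K, I, C, hK, hI, hC, φ ≪≫ₗ α, ψ.symm ≪≫ₗ β, fun x => by simp [h]⟩

theorem HasType.prodMap {f : X →ₗ[Rᵐᵒᵖ] Y} {g : X' →ₗ[Rᵐᵒᵖ] Y'} {k i c k' i' c' : V R}
    (hf : HasType f k i c) (hg : HasType g k' i' c') :
    HasType (f.prodMap g) (k + k') (i + i') (c + c') := by
  obtain ⟨K, I, C, rfl, rfl, rfl, α, β, hf⟩ := hf
  obtain ⟨K', I', C', rfl, rfl, rfl, α', β', hg⟩ := hg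
  refine ⟨K.sum K', I.sum I', C.sum C', rfl, rfl, rfl,
    α.prodCongr α' ≪≫ₗ LinearEquiv.prodProdProdComm Rᵐᵒᵖ _ _ _ _,
    β.prodCongr β' ≪≫ₗ LinearEquiv.prodProdProdComm Rᵐᵒᵖ _ _ _ _, fun x => ?_⟩
  change (((β (f x.1)).1, (β' (g x.2)).1), ((β (f x.1)).2, (β' (g x.2)).2)) = _
  rw [hf, hg]
  rfl

theorem HasType.source [Module.Finite Rᵐᵒᵖ X] [Module.Projective Rᵐᵒᵖ X]
    {f : X →ₗ[Rᵐᵒᵖ] Y} {k i c : V R} (h : HasType f k i c) :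
    k + i = V.of R X := by
  obtain ⟨K, I, C, rfl, rfl, rfl, α, β, h⟩ := h
  rw [add_comm]
  exact (V.mk_eq_mk.2 ⟨α⟩ : V.of R X = V.mk (I.sum K)).symm

theorem HasType.target [Module.Finite Rᵐᵒᵖ Y] [Module.Projective Rᵐᵒᵖ Y]
    {f : X →ₗ[Rᵐᵒᵖ] Y} {k i c : V R} (h : HasType f k i c) :
    i + c = V.of R Y := by
  obtain ⟨K, I, C, rfl, rfl, rfl, α, β, h⟩ := h
  exact (V.mk_eq_mk.2 ⟨β⟩ : V.of R Y = V.mk (I.sum C)).symm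

section Projective

variable [Module.Finite Rᵐᵒᵖ X] [Module.Projective Rᵐᵒᵖ X]
  [Module.Finite Rᵐᵒᵖ Y] [Module.Projective Rᵐᵒᵖ Y]

theorem exists_hasType {k i c : V R} (hk : k + i = V.of R X) (hc : i + c = V.of R Y) :
    ∃ f : X →ₗ[Rᵐᵒᵖ] Y, HasType f k i c := by
  obtain ⟨K, rfl⟩ := V.exists_rep k
  obtain ⟨I, rfl⟩ := V.exists_rep i
  obtain ⟨C, rfl⟩ := V.exists_rep c
  rw [add_comm] at hk
  obtain ⟨α⟩ := (V.mk_eq_mk (A := ⟨X⟩) (B := I.sum K)).1 hk.symm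
  obtain ⟨β⟩ := (V.mk_eq_mk (A := ⟨Y⟩) (B := I.sum C)).1 hc.symm
  exact ⟨β.symm.toLinearMap ∘ₗ LinearMap.inl Rᵐᵒᵖ I.carrier C.carrier ∘ₗ
    LinearMap.fst Rᵐᵒᵖ I.carrier K.carrier ∘ₗ α.toLinearMap,
    K, I, C, rfl, rfl, rfl, α, β, fun x => β.apply_symm_apply _⟩

theorem hasType_zero : HasType (0 : X →ₗ[Rᵐᵒᵖ] Y) (V.of R X) 0 (V.of R Y) :=
  ⟨⟨X⟩, FGProj.zero R, ⟨Y⟩, rfl, rfl, rfl,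
    (LinearEquiv.uniqueProd : (PUnit.{u + 1} × X) ≃ₗ[Rᵐᵒᵖ] X).symm,
    (LinearEquiv.uniqueProd : (PUnit.{u + 1} × Y) ≃ₗ[Rᵐᵒᵖ] Y).symm, fun _ => rfl⟩

theorem finite_projective_of_equiv_prod {A B : Type u} [AddCommGroup A] [Module Rᵐᵒᵖ A]
    [AddCommGroup B] [Module Rᵐᵒᵖ B] (e : X ≃ₗ[Rᵐᵒᵖ] A × B) :
    (Module.Finite Rᵐᵒᵖ A ∧ Module.Projective Rᵐᵒᵖ A) ∧
      (Module.Finite Rᵐᵒᵖ B ∧ Module.Projective Rᵐᵒᵖ B) := by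
  refine ⟨⟨Module.Finite.of_surjective (LinearMap.fst _ _ _ ∘ₗ e.toLinearMap) ?_,
      Module.Projective.of_split (e.symm.toLinearMap ∘ₗ LinearMap.inl _ _ _)
        (LinearMap.fst _ _ _ ∘ₗ e.toLinearMap) ?_⟩,
    ⟨Module.Finite.of_surjective (LinearMap.snd _ _ _ ∘ₗ e.toLinearMap) ?_,
      Module.Projective.of_split (e.symm.toLinearMap ∘ₗ LinearMap.inr _ _ _)
        (LinearMap.snd _ _ _ ∘ₗ e.toLinearMap) ?_⟩⟩
  · exact fun a => ⟨e.symm (a, 0), by simp⟩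
  · ext a; simp
  · exact fun a => ⟨e.symm (0, a), by simp⟩
  · ext a; simp

/-- When `f g f = f`, both `g f` and `f g` are idempotent: the first splits `ker f` off `X`, the
second splits `range f` off `Y` with complement `ker (f g)`. -/
theorem IsRegularMap.exists_hasType {f : X →ₗ[Rᵐᵒᵖ] Y} (h : IsRegularMap f) :
    ∃ k i c : V R, HasType f k i c := by
  obtain ⟨g, h⟩ := h
  have hr : ∀ y : LinearMap.range f, f (g y) = y := by
    rintro ⟨_, x, rfl⟩; exact h x
  have hk : ∀ z : LinearMap.ker f, f z = 0 := fun z => z.2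
  let α : X ≃ₗ[Rᵐᵒᵖ] LinearMap.range f × LinearMap.ker f :=
    LinearEquiv.ofLinearMap
      (f.rangeRestrict.prod ((LinearMap.id - g ∘ₗ f).codRestrict (LinearMap.ker f)
        fun x => by simp [h]))
      ((g ∘ₗ (LinearMap.range f).subtype).coprod (LinearMap.ker f).subtype)
      (by
        ext x
        · simp [hr]
        · simp [hr]
        · simp [hk]
        · simp [hk])
      (by ext x; simp)
  let β : Y ≃ₗ[Rᵐᵒᵖ] LinearMap.range f × LinearMap.ker (f ∘ₗ g) :=
    LinearEquiv.ofLinearMap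
      ((f.rangeRestrict ∘ₗ g).prod ((LinearMap.id - f ∘ₗ g).codRestrict (LinearMap.ker (f ∘ₗ g))
        fun x => by simp [h]))
      ((LinearMap.range f).subtype.coprod (LinearMap.ker (f ∘ₗ g)).subtype)
      (by
        ext x
        · simp [hr]
        · simp [hr]
        · simp
        · simp)
      (by ext x; simp)
  obtain ⟨⟨_, _⟩, _, _⟩ := finite_projective_of_equiv_prod α
  obtain ⟨-, _, _⟩ := finite_projective_of_equiv_prod β
  refine ⟨_, _, _, ⟨LinearMap.ker f⟩, ⟨LinearMap.range f⟩, ⟨LinearMap.ker (f ∘ₗ g)⟩,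
    rfl, rfl, rfl, α, β, fun x => ?_⟩
  ext
  · simp [α, β, h]
  · simp [β, h]

end Projective

/-- Both decompositions of `X` have the same second summand `ker f`, so `K ≅ K'`, and passing to the
quotient by it gives `I ≅ I'`. -/
theorem HasType.unique {f : X →ₗ[Rᵐᵒᵖ] Y} {k i c k' i' c' : V R} (h : HasType f k i c)
    (h' : HasType f k' i' c') : k = k' ∧ i = i' := by
  obtain ⟨K, I, C, rfl, rfl, rfl, α, β, h⟩ := h
  obtain ⟨K', I', C', rfl, rfl, rfl, α', β', h'⟩ := h'
  have ker_iff : ∀ x, (α x).1 = 0 ↔ f x = 0 := fun x => by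
    rw [← β.map_eq_zero_iff, h]; simp
  have ker_iff' : ∀ x, (α' x).1 = 0 ↔ f x = 0 := fun x => by
    rw [← β'.map_eq_zero_iff, h']; simp
  have key : ∀ x, (α x).1 = 0 ↔ (α' x).1 = 0 := fun x => (ker_iff x).trans (ker_iff' x).symm
  have h₁ : ∀ z, (α' (α.symm (0, z))).1 = 0 := fun z => (key _).1 (by simp)
  have h₂ : ∀ z, (α (α'.symm (0, z))).1 = 0 := fun z => (key _).2 (by simp)
  have h₃ : ∀ z, (0, (α' (α.symm (0, z))).2) = α' (α.symm (0, z)) := fun z =>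
    Prod.ext (h₁ z).symm rfl
  have h₄ : ∀ z, (0, (α (α'.symm (0, z))).2) = α (α'.symm (0, z)) := fun z =>
    Prod.ext (h₂ z).symm rfl
  have h₅ : ∀ z w, (α z).1 = (α w).1 → (α' z).1 = (α' w).1 := fun z w e => by
    have := (key (z - w)).1 (by simp [e])
    simpa [sub_eq_zero] using this
  have h₆ : ∀ z w, (α' z).1 = (α' w).1 → (α z).1 = (α w).1 := fun z w e => by
    have := (key (z - w)).2 (by simp [e])
    simpa [sub_eq_zero] using this
  constructor
  · refine V.mk_eq_mk.2 ⟨LinearEquiv.ofLinearMap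
      (LinearMap.snd _ _ _ ∘ₗ α'.toLinearMap ∘ₗ α.symm.toLinearMap ∘ₗ LinearMap.inr _ _ _)
      (LinearMap.snd _ _ _ ∘ₗ α.toLinearMap ∘ₗ α'.symm.toLinearMap ∘ₗ LinearMap.inr _ _ _) ?_ ?_⟩
    · ext z; simp [h₄]
    · ext z; simp [h₃]
  · refine V.mk_eq_mk.2 ⟨LinearEquiv.ofLinearMap
      (LinearMap.fst _ _ _ ∘ₗ α'.toLinearMap ∘ₗ α.symm.toLinearMap ∘ₗ LinearMap.inl _ _ _)
      (LinearMap.fst _ _ _ ∘ₗ α.toLinearMap ∘ₗ α'.symm.toLinearMap ∘ₗ LinearMap.inl _ _ _) ?_ ?_⟩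
    · ext z
      have := h₅ (α.symm ((α (α'.symm (z, 0))).1, 0)) (α'.symm (z, 0)) (by simp)
      simpa using this
    · ext z
      have := h₆ (α'.symm ((α' (α.symm (z, 0))).1, 0)) (α.symm (z, 0)) (by simp)
      simpa using this

end Types

/-! ### Matrices as maps of free modules, and diagonal reduction. -/

section Matrices

variable {l m n : ℕ}

/-- The map of right modules `x ↦ M x` on columns. -/
def mulVecRight (M : Matrix (Fin m) (Fin n) R) : (Fin n → R) →ₗ[Rᵐᵒᵖ] (Fin m → R) :=
  Matrix.mulVecBilin R Rᵐᵒᵖ M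

@[simp] theorem mulVecRight_apply (M : Matrix (Fin m) (Fin n) R) (x : Fin n → R) :
    mulVecRight M x = M.mulVec x := rfl

/-- The matrix of a map of free right modules. -/
def matrixOf (f : (Fin n → R) →ₗ[Rᵐᵒᵖ] (Fin m → R)) : Matrix (Fin m) (Fin n) R :=
  fun i j => f (Pi.single j 1) i

theorem matrixOf_mulVec (f : (Fin n → R) →ₗ[Rᵐᵒᵖ] (Fin m → R)) (x : Fin n → R) :
    (matrixOf f).mulVec x = f x := by
  have hx : x = ∑ j, MulOpposite.op (x j) • (Pi.single j 1 : Fin n → R) := by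
    ext i
    simp [Finset.sum_apply, Pi.single_apply]
  conv_rhs => rw [hx, map_sum]
  ext i
  simp [Matrix.mulVec, dotProduct, matrixOf, Finset.sum_apply]

theorem mulVecRight_matrixOf (f : (Fin n → R) →ₗ[Rᵐᵒᵖ] (Fin m → R)) :
    mulVecRight (matrixOf f) = f := LinearMap.ext (matrixOf_mulVec f)

theorem mulVec_single_apply (M : Matrix (Fin m) (Fin n) R) (i : Fin m) (j : Fin n) :
    M.mulVec (Pi.single j 1) i = M i j := by simp

theorem matrix_ext_mulVec {M N : Matrix (Fin m) (Fin n) R} (h : ∀ x, M.mulVec x = N.mulVec x) :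
    M = N := by
  ext i j
  simpa using congrFun (h (Pi.single j 1)) i

/-- The invertible matrix of an automorphism of a free right module. -/
def unitOf (e : (Fin n → R) ≃ₗ[Rᵐᵒᵖ] (Fin n → R)) : (Matrix (Fin n) (Fin n) R)ˣ where
  val := matrixOf e.toLinearMap
  inv := matrixOf e.symm.toLinearMap
  val_inv := matrix_ext_mulVec fun x => by simp [← Matrix.mulVec_mulVec, matrixOf_mulVec]
  inv_val := matrix_ext_mulVec fun x => by simp [← Matrix.mulVec_mulVec, matrixOf_mulVec]

/-- The automorphism of a free right module given by an invertible matrix. -/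
def equivOf (P : (Matrix (Fin n) (Fin n) R)ˣ) : (Fin n → R) ≃ₗ[Rᵐᵒᵖ] (Fin n → R) :=
  LinearEquiv.ofLinearMap (mulVecRight P.1) (mulVecRight P⁻¹.1)
    (LinearMap.ext fun x => by simp) (LinearMap.ext fun x => by simp)

theorem isRegularMatrix_iff {M : Matrix (Fin m) (Fin n) R} :
    IsRegularMatrix M ↔ IsRegularMap (mulVecRight M) := by
  constructor
  · rintro ⟨g, hg⟩
    exact ⟨mulVecRight g, fun x => by simp [← Matrix.mul_assoc, hg]⟩
  · rintro ⟨g, hg⟩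
    refine ⟨matrixOf g, matrix_ext_mulVec fun x => ?_⟩
    rw [← Matrix.mulVec_mulVec, ← Matrix.mulVec_mulVec, matrixOf_mulVec]
    exact hg x

/-- The off-diagonal entries of the matrix of `f` vanish. -/
def IsDiagonalMap (f : (Fin n → R) →ₗ[Rᵐᵒᵖ] (Fin m → R)) : Prop :=
  ∀ (i : Fin m) (j : Fin n), (i : ℕ) ≠ (j : ℕ) → f (Pi.single j 1) i = 0

theorem admitsDiagonalReduction_iff {M : Matrix (Fin m) (Fin n) R} :
    AdmitsDiagonalReduction M ↔
      ∃ (φ : (Fin n → R) ≃ₗ[Rᵐᵒᵖ] (Fin n → R)) (ψ : (Fin m → R) ≃ₗ[Rᵐᵒᵖ] (Fin m → R)),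
        IsDiagonalMap (ψ.toLinearMap ∘ₗ mulVecRight M ∘ₗ φ.toLinearMap) := by
  constructor
  · rintro ⟨P, Q, h⟩
    refine ⟨equivOf Q, equivOf P, fun i j hij => Eq.trans ?_ (h i j hij)⟩
    refine Eq.trans ?_ (mulVec_single_apply (P.1 * M * Q.1) i j)
    rw [← Matrix.mulVec_mulVec, ← Matrix.mulVec_mulVec]
    rfl
  · rintro ⟨φ, ψ, h⟩
    refine ⟨unitOf ψ, unitOf φ, fun i j hij => ?_⟩
    rw [← h i j hij]
    refine (mulVec_single_apply _ i j).symm.trans ?_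
    rw [← Matrix.mulVec_mulVec, ← Matrix.mulVec_mulVec]
    simp only [unitOf, matrixOf_mulVec]
    rfl

variable (R) in
/-- There is a diagonal `m × n` matrix of type `(k, i, c)`. -/
def ExistsDiagonal (m n : ℕ) (k i c : V R) : Prop :=
  ∃ f : (Fin n → R) →ₗ[Rᵐᵒᵖ] (Fin m → R), IsDiagonalMap f ∧ HasType f k i c

theorem existsDiagonal_zero (a b : ℕ) :
    ExistsDiagonal R a b (b • V.of R R) 0 (a • V.of R R) := by
  refine ⟨0, fun _ _ _ => rfl, ?_⟩
  rw [← V.of_fin, ← V.of_fin]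
  exact hasType_zero

theorem ExistsDiagonal.succ {k i c k₁ i₁ c₁ : V R} (h : ExistsDiagonal R m n k i c)
    (hk : k₁ + i₁ = V.of R R) (hc : i₁ + c₁ = V.of R R) :
    ExistsDiagonal R (m + 1) (n + 1) (k₁ + k) (i₁ + i) (c₁ + c) := by
  obtain ⟨f, hf, ht⟩ := h
  obtain ⟨d, hd⟩ := exists_hasType hk hc
  refine ⟨_, ?_, (hd.prodMap ht).comp_equiv
    (Fin.consLinearEquiv Rᵐᵒᵖ fun _ : Fin (n + 1) => R).symm
    (Fin.consLinearEquiv Rᵐᵒᵖ fun _ : Fin (m + 1) => R)⟩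
  intro i j hij
  have h₀ : Fin.tail (Pi.single 0 1 : Fin (n + 1) → R) = 0 := by
    ext j; simp [Fin.tail]
  have h₁ (j : Fin n) : Fin.tail (Pi.single j.succ 1 : Fin (n + 1) → R) = Pi.single j 1 := by
    ext k; simp [Fin.tail, Pi.single_apply]
  induction j using Fin.cases with
  | zero =>
    induction i using Fin.cases with
    | zero => simp at hij
    | succ i => simp [h₀]
  | succ j =>
    induction i using Fin.cases with
    | zero => simp
    | succ i =>
      have := hf i j (by simpa using hij)
      simpa [h₁] using this

/-- The zero `a × b` rectangle in the last rows and columns absorbs the excess; each induction step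
puts one `1 × 1` block in the top left corner. -/
theorem existsDiagonal_of_cancelsTwo (hR : IsRefinementRing R) (hu : CancelsTwo (V.of R R))
    (a b n : ℕ) {k i c : V R} (hk : k + i = (n + 1) • V.of R R) (hc : i + c = (n + 1) • V.of R R) :
    ExistsDiagonal R (a + (n + 1)) (b + (n + 1)) (k + b • V.of R R) i (c + a • V.of R R) := by
  induction n generalizing k i c with
  | zero =>
    have := (existsDiagonal_zero (R := R) a b).succ (k₁ := k) (i₁ := i) (c₁ := c)
      (by simpa using hk) (by simpa using hc)
    rwa [add_zero] at this
  | succ n ih =>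
    obtain ⟨k₁, k₂, i₁, i₂, c₁, c₂, rfl, rfl, rfl, h₁, h₂, h₃, h₄⟩ := hu.split hR n hk hc
    have := (ih h₃ h₄).succ h₁ h₂
    rwa [← add_assoc k₁, ← add_assoc c₁, add_comm k₁, add_comm i₁, add_comm c₁] at this

theorem admitsDiagonalReduction_of_cancelsTwo (hR : IsRefinementRing R)
    (hu : CancelsTwo (V.of R R)) {f : Matrix (Fin m) (Fin n) R} (hf : IsRegularMatrix f) :
    AdmitsDiagonalReduction f := by
  rcases Nat.eq_zero_or_pos m with rfl | hm
  · exact ⟨1, 1, fun i => i.elim0⟩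
  rcases Nat.eq_zero_or_pos n with rfl | hn
  · exact ⟨1, 1, fun _ j => j.elim0⟩
  obtain ⟨k, i, c, ht⟩ := (isRegularMatrix_iff.1 hf).exists_hasType
  have hk := ht.source
  have hc := ht.target
  rw [V.of_fin] at hk hc
  have hd : ExistsDiagonal R m n k i c := by
    rcases le_total m n with h | h
    · obtain ⟨b, rfl⟩ := Nat.exists_eq_add_of_le' h
      obtain ⟨m, rfl⟩ := Nat.exists_eq_add_of_le' hm
      obtain ⟨k', rfl, hk'⟩ := hu.exists_eq_add_nsmul (m + 1) b hk hc
      simpa using existsDiagonal_of_cancelsTwo hR hu 0 b m hk' hc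
    -- The tall case is the wide one with kernel and cokernel exchanged.
    · obtain ⟨a, rfl⟩ := Nat.exists_eq_add_of_le' h
      obtain ⟨n, rfl⟩ := Nat.exists_eq_add_of_le' hn
      obtain ⟨c', rfl, hc'⟩ := hu.exists_eq_add_nsmul (n + 1) a ((add_comm _ _).trans hc)
        ((add_comm _ _).trans hk)
      simpa using existsDiagonal_of_cancelsTwo hR hu a 0 n hk ((add_comm _ _).trans hc')
  obtain ⟨g, hg, hgt⟩ := hd
  obtain ⟨φ, ψ, h⟩ := ht.equivalent hgt
  refine admitsDiagonalReduction_iff.2 ⟨φ, ψ, ?_⟩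
  rwa [show ψ.toLinearMap ∘ₗ mulVecRight f ∘ₗ φ.toLinearMap = g from LinearMap.ext h]

/-- A regular diagonal `1 × 2` matrix has a free summand in its kernel. -/
theorem exists_eq_add_of_isDiagonalMap {f : (Fin 2 → R) →ₗ[Rᵐᵒᵖ] (Fin 1 → R)} {k i c : V R}
    (hf : IsDiagonalMap f) (ht : HasType f k i c) :
    ∃ k₁, k = k₁ + V.of R R ∧ k₁ + i = V.of R R := by
  let e := Fin.consLinearEquiv Rᵐᵒᵖ fun _ : Fin 2 => R
  have h₁ : ∀ y : Fin 1 → R, f (e (0, y)) = 0 := fun y => by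
    have h₂ : e (0, y) = MulOpposite.op (y 0) • (Pi.single 1 1 : Fin 2 → R) := by
      ext j; fin_cases j <;> simp [e]
    have h₃ : f (Pi.single 1 1) = 0 := by
      ext j; fin_cases j; exact hf 0 1 (by simp)
    rw [h₂, map_smul, h₃, smul_zero]
  have h₄ : ∀ x, f (e x) = f (e (x.1, 0)) := fun x => by
    have : x = (x.1, 0) + (0, x.2) := by simp
    conv_lhs => rw [this, map_add, map_add, h₁, add_zero]
  -- The second column of `f` vanishes, so `d` is its first column, and `ker f` is `ker d` plus a
  -- free summand.
  let d : R →ₗ[Rᵐᵒᵖ] (Fin 1 → R) := f ∘ₗ e.toLinearMap ∘ₗ LinearMap.inl _ _ _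
  have hd : IsRegularMap d := by
    obtain ⟨g, hg⟩ := ht.isRegularMap
    refine ⟨LinearMap.fst _ _ _ ∘ₗ e.symm.toLinearMap ∘ₗ g, fun x => ?_⟩
    have h₅ : ∀ y, d (e.symm y).1 = f y := fun y => by
      have := h₄ (e.symm y)
      rw [e.apply_symm_apply] at this
      exact this.symm
    exact (h₅ _).trans (hg _)
  obtain ⟨k₁, i₁, c₁, K, I, C, rfl, rfl, rfl, α, β, hαβ⟩ := hd.exists_hasType
  have hk₁ : V.mk K + V.mk I = V.of R R :=
    HasType.source (f := d) ⟨K, I, C, rfl, rfl, rfl, α, β, hαβ⟩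
  have ht' : HasType f (V.mk K + V.of R (Fin 1 → R)) (V.mk I) (V.mk C) := by
    refine ⟨K.sum ⟨Fin 1 → R⟩, I, C, rfl, rfl, rfl,
      e.symm ≪≫ₗ α.prodCongr (LinearEquiv.refl _ _) ≪≫ₗ LinearEquiv.prodAssoc Rᵐᵒᵖ _ _ _, β,
      fun x => ?_⟩
    obtain ⟨x, rfl⟩ := e.surjective x
    rw [h₄]
    refine (hαβ x.1).trans ?_
    change _ = ((α (e.symm (e x)).1).1, 0)
    rw [e.symm_apply_apply]
  obtain ⟨rfl, rfl⟩ := ht.unique ht'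
  exact ⟨V.mk K, by rw [V.of_fin, one_nsmul], hk₁⟩

theorem cancelsTwo_of_admitsDiagonalReduction (hR : IsRefinementRing R)
    (h : ∀ f : Matrix (Fin 1) (Fin 2) R, IsRegularMatrix f → AdmitsDiagonalReduction f) :
    CancelsTwo (V.of R R) := by
  intro a b hab
  obtain ⟨p, q, x₃, y₃, hpq, rfl, hu, rfl⟩ := HasRefinement.two_two hR hab
  -- The refinement pieces prescribe a map `2R → R` with kernel `q`, image `p` and cokernel `x₃`.
  have hsrc : q + p = V.of R (Fin 2 → R) := by rw [V.of_fin, two_nsmul, hpq, add_comm]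
  have htgt : p + x₃ = V.of R (Fin 1 → R) := by rw [V.of_fin, one_nsmul, hu]
  obtain ⟨f, hf⟩ := exists_hasType hsrc htgt
  obtain ⟨φ, ψ, hd⟩ := admitsDiagonalReduction_iff.1 (h (matrixOf f)
    (isRegularMatrix_iff.2 (by rw [mulVecRight_matrixOf]; exact hf.isRegularMap)))
  rw [mulVecRight_matrixOf] at hd
  obtain ⟨k₁, rfl, hk₁⟩ := exists_eq_add_of_isDiagonalMap hd (hf.comp_equiv φ ψ)
  calc V.of R R + (x₃ + y₃) = (k₁ + p) + (x₃ + y₃) := by rw [hk₁]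
    _ = k₁ + (p + x₃) + y₃ := by abel
    _ = k₁ + V.of R R + y₃ := by rw [← hu]

end Matrices

end RefinementRing

theorem theorem3p5 (R : Type u) [Ring R] (hR : RefinementRing.IsRefinementRing R) :
    (∀ (m n : ℕ) (f : Matrix (Fin m) (Fin n) R), RefinementRing.IsRegularMatrix f →
        RefinementRing.AdmitsDiagonalReduction f) ↔
      (∀ (A B : Type u) [AddCommGroup A] [Module Rᵐᵒᵖ A] [AddCommGroup B] [Module Rᵐᵒᵖ B]
        [Module.Finite Rᵐᵒᵖ A] [Module.Projective Rᵐᵒᵖ A]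
        [Module.Finite Rᵐᵒᵖ B] [Module.Projective Rᵐᵒᵖ B],
        Nonempty (((R × R) × A) ≃ₗ[Rᵐᵒᵖ] (R × B)) → Nonempty ((R × A) ≃ₗ[Rᵐᵒᵖ] B)) := by
  constructor
  · intro h A B _ _ _ _ _ _ _ _ e
    have hu := RefinementRing.cancelsTwo_of_admitsDiagonalReduction hR (h 1 2)
    exact RefinementRing.V.of_eq_of.1 (hu (.of R A) (.of R B) (RefinementRing.V.of_eq_of.2 e))
  · intro h m n f hf
    refine RefinementRing.admitsDiagonalReduction_of_cancelsTwo hR (fun a b hab => ?_) hf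
    obtain ⟨A, rfl⟩ := a.exists_rep
    obtain ⟨B, rfl⟩ := b.exists_rep
    exact RefinementRing.V.of_eq_of.2 (h A.carrier B.carrier (RefinementRing.V.of_eq_of.1 hab))
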